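/- Let $X$ be a metric space and $\varepsilon>0$. An $\varepsilon$-chain in $X$ is a finite sequence $\{x_0,\dots,x_n\}$ ($n\ge 0$) of points of $X$ with $d(x_{i},x_{i+1})<\varepsilon$ for all $0\le i<n$; it is an $\varepsilon$-loop if $x_n=x_0$. An $\varepsilon$-loop $\{x_0,\dots,x_n=x_0\}$ is $\varepsilon$-null if it can be transformed into the one-point loop $\{x_0\}$ in finitely many steps, each of which adds or removes a single point so that the result is again an $\varepsilon$-chain with the same endpoints. An $\varepsilon$-loop is $\varepsilon$-critical if it is not $\varepsilon$-null but is $\delta$-null for every $\delta>\varepsilon$, and $\varepsilon$ is a homotopy critical value of $X$ if $X$ contains an $\varepsilon$-critical $\varepsilon$-loop. The space $X$ is geodesic if any two points $x,y\in X$ are joined by a geodesic, that is, by a distance-preserving map $\gamma\colon[0,d(x,y)]\to X$ with $\gamma(0)=x$ and $\gamma(d(x,y))=y$. An essential $\varepsilon$-circle in a geodesic space $X$ is a set $C\subseteq X$ that is the image of an arclength parameterized loop $c\colon[0,3\varepsilon]\to X$ (that is, $c(0)=c(3\varepsilon)$ and $c|_{[s,t]}$ has length $t-s$ for all $0\le s\le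 t\le 3\varepsilon$) and that contains (all points of) an $\varepsilon$-loop that is not $\varepsilon$-null in $X$. Theorem. If $X$ is a compact geodesic space and $\varepsilon>0$, then $\varepsilon$ is a homotopy critical value of $X$ if and only if $X$ contains an essential $\varepsilon$-circle. -/

import Mathlib

namespace DiscreteHomotopy

variable {X : Type*} [MetricSpace X]

/-- A metric space is geodesic if any two points `x`, `y` are joined by a geodesic, that is, by an
arclength parameterized length minimizing curve. Such a curve is a distance preserving map from
`[0, d(x, y)]`. The map is given on `ℝ`, its values outside of the interval play no role. -/
def IsGeodesicSpace (X : Type*) [MetricSpace X] : Prop :=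
  ∀ x y : X, ∃ γ : ℝ → X, γ 0 = x ∧ γ (dist x y) = y ∧
    ∀ s ∈ Set.Icc 0 (dist x y), ∀ t ∈ Set.Icc 0 (dist x y), dist (γ s) (γ t) = |s - t|

/-- An `ε`-chain: a nonempty finite sequence `x₀, …, xₙ` with `d(xᵢ, xᵢ₊₁) < ε` for all `i`. -/
def IsEpsChain (ε : ℝ) (α : List X) : Prop :=
  α ≠ [] ∧ α.IsChain (fun x y => dist x y < ε)

/-- An `ε`-loop: an `ε`-chain `x₀, …, xₙ` with `xₙ = x₀`. -/
def IsEpsLoop (ε : ℝ) (α : List X) : Prop :=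
  IsEpsChain ε α ∧ α.head? = α.getLast?

/-- `β` arises from `α` by inserting one point (anywhere). -/
def InsertsPoint (α β : List X) : Prop :=
  ∃ (l₁ l₂ : List X) (x : X), α = l₁ ++ l₂ ∧ β = l₁ ++ x :: l₂

/-- `α` and `β` are `ε`-chains with the same endpoints that differ by a basic move: one arises from
the other by adding or removing a single point. -/
def BasicMove (ε : ℝ) (α β : List X) : Prop :=
  IsEpsChain ε α ∧ IsEpsChain ε β ∧ α.head? = β.head? ∧ α.getLast? = β.getLast? ∧
    (InsertsPoint α β ∨ InsertsPoint β α)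

/-- The `ε`-chain `α` is `ε`-homotopic to `β`: there is a finite sequence of basic moves, with fixed
endpoints and through `ε`-chains, from `α` to `β`. -/
def EpsHomotopic (ε : ℝ) (α β : List X) : Prop :=
  IsEpsChain ε α ∧ Relation.ReflTransGen (BasicMove ε) α β

/-- `α` is `ε`-null: it is an `ε`-loop that is `ε`-homotopic to the trivial loop at its first
point. -/
def IsEpsNull (ε : ℝ) (α : List X) : Prop :=
  IsEpsLoop ε α ∧ ∃ x : X, α.head? = some x ∧ EpsHomotopic ε α [x]

/-- An `ε`-loop is `ε`-critical if it is not `ε`-null but is `δ`-null for all `δ > ε`. -/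
def IsEpsCritical (ε : ℝ) (α : List X) : Prop :=
  IsEpsLoop ε α ∧ ¬ IsEpsNull ε α ∧ ∀ δ : ℝ, ε < δ → IsEpsNull δ α

/-- `ε` is a homotopy critical value of `X` if there is an `ε`-critical `ε`-loop in `X`. -/
def IsHomotopyCriticalValue (X : Type*) [MetricSpace X] (ε : ℝ) : Prop :=
  ∃ α : List X, IsEpsCritical ε α

/-- `c`, restricted to `[0, L]`, is an arclength parameterized loop of length `L`: the length of its
restriction to any `[s, t]` is `t - s`, and `c 0 = c L`. -/
def IsArclengthLoop (L : ℝ) (c : ℝ → X) : Prop :=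
  HasUnitSpeedOn c (Set.Icc 0 L) ∧ c 0 = c L

/-- `C` is an essential `ε`-circle: it is the image of an arclength parameterized loop of length
`3ε` and contains an `ε`-loop that is not `ε`-null in `X`. -/
def IsEssentialCircle (ε : ℝ) (C : Set X) : Prop :=
  (∃ c : ℝ → X, IsArclengthLoop (3 * ε) c ∧ C = c '' Set.Icc 0 (3 * ε)) ∧
    ∃ α : List X, IsEpsLoop ε α ∧ (∀ x ∈ α, x ∈ C) ∧ ¬ IsEpsNull ε α

end DiscreteHomotopy

/-!
Chains are computed with in the monoid of words in the points of `X`, modulo repeating a point and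
skipping a point of a small triangle.

Let `c` parameterize an essential `ε`-circle. A chain that goes once around it is `δ`-null for every
`δ > ε`, because it is `δ`-homotopic to a chain with three steps of length `ε`. If it were also
`ε`-null, then every step of an `ε`-chain on the circle would lift to an `ε`-chain of parameters, up
to `ε`-homotopy. All `ε`-loops on the circle would then be images of `ε`-loops of the real line,
which are `ε`-null.

Conversely, let `α` be an `ε`-critical loop and `ε < δ ≤ 2ε`. Inserting midpoints turns a
`δ`-homotopy that contracts `α` into an `ε`-homotopy, unless some triangle with sides less than `δ`,
subdivided into a hexagon with sides less than `δ / 2`, is not `ε`-null. By compactness the latter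
hexagons accumulate, as `δ → ε`, at a hexagon with sides at most `ε / 2` that is not `ε`-null. Any
two steps of it span a distance of at least `ε`, otherwise the hexagon could be filled. So all its
sides have length `ε / 2`, and joining its vertices by geodesics gives an essential `ε`-circle.
-/

namespace DiscreteHomotopy

variable {X : Type*} [MetricSpace X] {ε δ : ℝ} {α β γ : List X} {x y z : X}

/-! ### The monoid of chains -/

theorem BasicMove.symm (h : BasicMove ε α β) : BasicMove ε β α :=
  ⟨h.2.1, h.1, h.2.2.1.symm, h.2.2.2.1.symm, h.2.2.2.2.symm⟩

theorem InsertsPoint.exists_dup_or_between {X : Type*} {α β : List X} (hi : InsertsPoint α β)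
    (hα : α ≠ []) (hhead : α.head? = β.head?) (hlast : α.getLast? = β.getLast?) :
    (∃ l r x, α = l ++ x :: r ∧ β = l ++ x :: x :: r) ∨
      ∃ l r x y z, α = l ++ x :: z :: r ∧ β = l ++ x :: y :: z :: r := by
  obtain ⟨l₁, l₂, y, rfl, rfl⟩ := hi
  rcases List.eq_nil_or_concat l₁ with rfl | ⟨l, x, rfl⟩
  · obtain ⟨z, r, rfl⟩ := List.exists_cons_of_ne_nil hα
    obtain rfl : z = y := by simpa using hhead
    exact .inl ⟨[], r, z, rfl, rfl⟩
  · cases l₂ with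
    | nil =>
      obtain rfl : x = y := by simpa using hlast
      exact .inl ⟨l, [], x, by simp, by simp⟩
    | cons z r => exact .inr ⟨l, r, x, y, z, by simp, by simp⟩

namespace EpsHomotopic

theorem refl (h : IsEpsChain ε α) : EpsHomotopic ε α α := ⟨h, .refl⟩

theorem of_basicMove (h : BasicMove ε α β) : EpsHomotopic ε α β := ⟨h.1, .single h⟩

theorem trans (h : EpsHomotopic ε α β) (h' : EpsHomotopic ε β γ) : EpsHomotopic ε α γ :=
  ⟨h.1, h.2.trans h'.2⟩

theorem isEpsChain_right (h : EpsHomotopic ε α β) : IsEpsChain ε β := by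
  rcases Relation.ReflTransGen.cases_tail h.2 with h' | ⟨γ, -, h'⟩
  · exact h' ▸ h.1
  · exact h'.2.1

theorem symm (h : EpsHomotopic ε α β) : EpsHomotopic ε β α :=
  haveI : Std.Symm (BasicMove (X := X) ε) := ⟨fun _ _ hm => hm.symm⟩
  ⟨h.isEpsChain_right, Std.Symm.symm _ _ h.2⟩

theorem map_eq {M : Type*} {f : List X → M}
    (hdup : ∀ l r x, f (l ++ x :: x :: r) = f (l ++ x :: r))
    (hskip : ∀ l r x y z, dist x y < ε → dist y z < ε → dist x z < ε →
      f (l ++ x :: y :: z :: r) = f (l ++ x :: z :: r))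
    (h : EpsHomotopic ε α β) : f α = f β := by
  have of_insertsPoint : ∀ {α β : List X}, BasicMove ε α β → InsertsPoint α β → f α = f β := by
    rintro α β ⟨hα, hβ, hhead, hlast, -⟩ hi
    rcases hi.exists_dup_or_between hα.1 hhead hlast with
      ⟨l, r, x, rfl, rfl⟩ | ⟨l, r, x, y, z, rfl, rfl⟩
    · exact (hdup l r x).symm
    · have hα := hα.2
      have hβ := hβ.2
      simp only [List.isChain_append, List.isChain_cons_cons] at hα hβ
      exact (hskip l r x y z hβ.2.1.1 hβ.2.1.2.1 hα.2.1.1).symm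
  obtain ⟨-, h⟩ := h
  induction h with
  | refl => rfl
  | tail _ hm ih =>
    rcases hm.2.2.2.2 with hi | hi
    · exact ih.trans (of_insertsPoint hm hi)
    · exact ih.trans (of_insertsPoint hm.symm hi).symm

end EpsHomotopic

/-- The relations between words in the points of `X` that generate `ε`-homotopy of `ε`-chains:
repeating a point, and passing through an intermediate point. -/
inductive ChainRel (ε : ℝ) : FreeMonoid X → FreeMonoid X → Prop
  | dup (x : X) : ChainRel ε (.ofList [x, x]) (.ofList [x])
  | skip {x y z : X} (hxy : dist x y < ε) (hyz : dist y z < ε) (hxz : dist x z < ε) :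
      ChainRel ε (.ofList [x, y, z]) (.ofList [x, z])

/-- The monoid of words in the points of `X` modulo `ChainRel ε`. By `epsHomotopic_iff`, two
`ε`-chains have the same class if and only if they are `ε`-homotopic. Multiplying classes
concatenates words, so that the product of two chains repeats their common endpoint. Words need not
be chains: calculations with classes carry no side condition on the neighboring letters. -/
abbrev ChainMonoid (X : Type*) [MetricSpace X] (ε : ℝ) : Type _ :=
  PresentedMonoid (ChainRel (X := X) ε)

/-- The class of a sequence of points in the monoid `ChainMonoid X ε`. -/
def chainClass (ε : ℝ) (α : List X) : ChainMonoid X ε :=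
  PresentedMonoid.mk (ChainRel ε) (FreeMonoid.ofList α)

theorem chainClass_append (ε : ℝ) (α β : List X) :
    chainClass ε (α ++ β) = chainClass ε α * chainClass ε β := rfl

theorem chainClass_cons (ε : ℝ) (x : X) (α : List X) :
    chainClass ε (x :: α) = chainClass ε [x] * chainClass ε α := rfl

theorem chainClass_congr (l r : List X) (h : chainClass ε α = chainClass ε β) :
    chainClass ε (l ++ α ++ r) = chainClass ε (l ++ β ++ r) := by
  simp only [chainClass_append, h]

theorem chainClass_dup (ε : ℝ) (l r : List X) (x : X) :
    chainClass ε (l ++ x :: x :: r) = chainClass ε (l ++ x :: r) := by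
  simpa using chainClass_congr l r (PresentedMonoid.mk_eq_mk_of_rel (ChainRel.dup (ε := ε) x))

theorem chainClass_skip (l r : List X) (hxy : dist x y < ε) (hyz : dist y z < ε)
    (hxz : dist x z < ε) :
    chainClass ε (l ++ x :: y :: z :: r) = chainClass ε (l ++ x :: z :: r) := by
  simpa using chainClass_congr l r (PresentedMonoid.mk_eq_mk_of_rel (ChainRel.skip hxy hyz hxz))

theorem chainClass_spur (l r : List X) (h : dist x y < ε) :
    chainClass ε (l ++ x :: y :: x :: r) = chainClass ε (l ++ x :: r) := by
  have hε : 0 < ε := dist_nonneg.trans_lt h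
  rw [chainClass_skip l r h (by rwa [dist_comm]) (by rwa [dist_self]), chainClass_dup]

theorem ChainRel.epsHomotopic {v w : FreeMonoid X} (hvw : ChainRel ε v w) (hε : 0 < ε)
    (l r : List X) (h : IsEpsChain ε (l ++ v.toList ++ r) ∨ IsEpsChain ε (l ++ w.toList ++ r)) :
    EpsHomotopic ε (l ++ v.toList ++ r) (l ++ w.toList ++ r) := by
  have of_iff : ∀ {α β : List X}, (IsEpsChain ε α ↔ IsEpsChain ε β) → α.head? = β.head? →
      α.getLast? = β.getLast? → InsertsPoint β α → (IsEpsChain ε α ∨ IsEpsChain ε β) →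
      EpsHomotopic ε α β := fun hαβ hhead hlast hi h =>
    .of_basicMove ⟨h.elim id hαβ.2, h.elim hαβ.1 id, hhead, hlast, .inr hi⟩
  cases hvw with
  | dup x =>
    refine of_iff ?_ (by simp [List.head?_append]) (by simp [List.getLast?_append])
      ⟨l ++ [x], r, x, by simp, by simp⟩ h
    simp [IsEpsChain, List.isChain_append, hε]
  | @skip x y z hxy hyz hxz =>
    refine of_iff ?_ (by simp [List.head?_append]) (by simp [List.getLast?_append])
      ⟨l ++ [x], z :: r, y, by simp, by simp⟩ h
    simp [IsEpsChain, List.isChain_append, hxy, hyz, hxz]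

theorem epsHomotopic_of_conGen {v w : FreeMonoid X} (hvw : conGen (ChainRel ε) v w) (hε : 0 < ε)
    (l r : List X) (h : IsEpsChain ε (l ++ v.toList ++ r) ∨ IsEpsChain ε (l ++ w.toList ++ r)) :
    EpsHomotopic ε (l ++ v.toList ++ r) (l ++ w.toList ++ r) := by
  change ConGen.Rel (ChainRel ε) v w at hvw
  induction hvw generalizing l r with
  | of _ _ hvw => exact hvw.epsHomotopic hε l r h
  | refl _ => exact .refl (h.elim id id)
  | symm _ ih => exact (ih l r h.symm).symm
  | trans _ _ ih₁ ih₂ =>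
    rcases h with h | h
    · have h₁ := ih₁ l r (.inl h)
      exact h₁.trans (ih₂ l r (.inl h₁.isEpsChain_right))
    · have h₂ := ih₂ l r (.inr h)
      exact (ih₁ l r (.inr h₂.1)).trans h₂
  | @mul v w v' w' _ _ ih₁ ih₂ =>
    have ih₁ := ih₁ l (v'.toList ++ r)
    have ih₂ := ih₂ (l ++ w.toList) r
    simp only [FreeMonoid.toList_mul, List.append_assoc] at h ih₁ ih₂ ⊢
    rcases h with h | h
    · have h₁ := ih₁ (.inl h)
      exact h₁.trans (ih₂ (.inl h₁.isEpsChain_right))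
    · have h₂ := ih₂ (.inr h)
      exact (ih₁ (.inr h₂.1)).trans h₂

theorem epsHomotopic_iff (hε : 0 < ε) (hα : IsEpsChain ε α) :
    EpsHomotopic ε α β ↔ chainClass ε α = chainClass ε β := by
  refine ⟨fun h => h.map_eq (chainClass_dup ε) fun l r _ _ _ => chainClass_skip l r, fun h => ?_⟩
  have := epsHomotopic_of_conGen (PresentedMonoid.mk_eq_mk_iff.1 h) hε [] []
  simp only [FreeMonoid.toList_ofList, List.nil_append, List.append_nil] at this
  exact this (.inl hα)

theorem dist_lt_of_lipschitzWith_one {Y : Type*} [MetricSpace Y] {c : X → Y}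
    (hc : LipschitzWith 1 c) (h : dist x y < ε) : dist (c x) (c y) < ε :=
  (hc.dist_le_mul x y).trans_lt (by simpa using h)

theorem chainClass_map_eq {Y : Type*} [MetricSpace Y] {c : X → Y} (hc : LipschitzWith 1 c)
    (h : chainClass ε α = chainClass ε β) : chainClass ε (α.map c) = chainClass ε (β.map c) := by
  have hlt : ∀ {x y}, dist x y < ε → dist (c x) (c y) < ε := dist_lt_of_lipschitzWith_one hc
  let push : ChainMonoid X ε →* ChainMonoid Y ε :=
    PresentedMonoid.lift (fun x => chainClass ε [c x]) <| by
      rintro _ _ (x | ⟨hxy, hyz, hxz⟩)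
      · exact chainClass_dup ε [] [] (c x)
      · exact chainClass_skip [] [] (hlt hxy) (hlt hyz) (hlt hxz)
  have hpush : ∀ α : List X, push (chainClass ε α) = chainClass ε (α.map c) := fun α => by
    induction α with
    | nil => exact map_one push
    | cons x α ih =>
      rw [chainClass_cons, map_mul, ih, List.map_cons, chainClass_cons ε (c x)]
      rfl
  rw [← hpush, ← hpush, h]

/-- The sequence `α` is an `ε`-chain with first point `x` and last point `y`. -/
structure IsEpsChainFromTo (ε : ℝ) (x y : X) (α : List X) : Prop where
  isEpsChain : IsEpsChain ε α
  head?_eq : α.head? = some x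
  getLast?_eq : α.getLast? = some y

namespace IsEpsChainFromTo

theorem append (hε : 0 < ε) (hα : IsEpsChainFromTo ε x y α) (hβ : IsEpsChainFromTo ε y z β) :
    IsEpsChainFromTo ε x z (α ++ β) where
  isEpsChain := ⟨by simp [hα.isEpsChain.1], List.isChain_append.2
    ⟨hα.isEpsChain.2, hβ.isEpsChain.2, by simp [hα.getLast?_eq, hβ.head?_eq, hε]⟩⟩
  head?_eq := by simp [List.head?_append, hα.head?_eq]
  getLast?_eq := by simp [List.getLast?_append, hβ.getLast?_eq]

theorem reverse (hα : IsEpsChainFromTo ε x y α) : IsEpsChainFromTo ε y x α.reverse where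
  isEpsChain := ⟨by simp [hα.isEpsChain.1], by
    simpa only [List.isChain_reverse, flip, dist_comm] using hα.isEpsChain.2⟩
  head?_eq := by simp [hα.getLast?_eq]
  getLast?_eq := by simp [hα.head?_eq]

theorem map {Y : Type*} [MetricSpace Y] {c : X → Y} (hc : LipschitzWith 1 c)
    (hα : IsEpsChainFromTo ε x y α) : IsEpsChainFromTo ε (c x) (c y) (α.map c) where
  isEpsChain := ⟨by simp [hα.isEpsChain.1], (List.isChain_map c).2 <| hα.isEpsChain.2.imp
    fun _ _ => dist_lt_of_lipschitzWith_one hc⟩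
  head?_eq := by simp [hα.head?_eq]
  getLast?_eq := by simp [hα.getLast?_eq]

theorem chainClass_singleton_mul (hα : IsEpsChainFromTo ε x y α) :
    chainClass ε [x] * chainClass ε α = chainClass ε α := by
  obtain ⟨l, rfl⟩ := List.head?_eq_some_iff.1 hα.head?_eq
  exact chainClass_dup ε [] l x

theorem chainClass_mul_singleton (hα : IsEpsChainFromTo ε x y α) :
    chainClass ε α * chainClass ε [y] = chainClass ε α := by
  obtain ⟨l, rfl⟩ := List.getLast?_eq_some_iff.1 hα.getLast?_eq
  rw [← chainClass_append, List.append_assoc]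
  exact chainClass_dup ε l [] y

theorem chainClass_reverse_mul (hα : IsEpsChainFromTo ε x y α) :
    chainClass ε α.reverse * chainClass ε α = chainClass ε [y] := by
  obtain ⟨⟨-, hchain⟩, hx, hy⟩ := hα
  induction α generalizing x with
  | nil => simp at hx
  | cons a l ih =>
    rw [List.reverse_cons, ← chainClass_append, List.append_assoc, List.singleton_append,
      chainClass_dup]
    cases l with
    | nil => simpa using congrArg (chainClass ε [·]) (Option.some.inj hy)
    | cons b l =>
      rw [List.isChain_cons_cons] at hchain
      have hba : dist b a < ε := by rw [dist_comm]; exact hchain.1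
      have hb := ih rfl hy hchain.2
      rw [List.reverse_cons, ← chainClass_append, List.append_assoc, List.singleton_append,
        chainClass_dup] at hb
      simpa using (chainClass_spur l.reverse l hba).trans hb

theorem chainClass_reverse_of_null (hα : IsEpsChainFromTo ε x x α)
    (h : chainClass ε α = chainClass ε [x]) : chainClass ε α.reverse = chainClass ε [x] := by
  rw [← hα.reverse.chainClass_mul_singleton, ← h, hα.chainClass_reverse_mul, h]

theorem isEpsLoop (hα : IsEpsChainFromTo ε x x α) : IsEpsLoop ε α :=
  ⟨hα.isEpsChain, hα.head?_eq.trans hα.getLast?_eq.symm⟩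

theorem isEpsNull_iff (hε : 0 < ε) (hα : IsEpsChainFromTo ε x x α) :
    IsEpsNull ε α ↔ chainClass ε α = chainClass ε [x] := by
  simp [IsEpsNull, hα.isEpsLoop, hα.head?_eq, epsHomotopic_iff hε hα.isEpsChain]

end IsEpsChainFromTo

theorem IsEpsLoop.exists_isEpsChainFromTo (hα : IsEpsLoop ε α) :
    ∃ x, IsEpsChainFromTo ε x x α := by
  obtain ⟨x, l, rfl⟩ := List.exists_cons_of_ne_nil hα.1.1
  exact ⟨x, hα.1, rfl, hα.2.symm⟩

/-! ### Chains on the real line -/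

theorem exists_chainClass_cons_eq_of_isChain {r : ℝ → ℝ → Prop} [Std.Trichotomous r]
    (hr : ∀ {a b c}, r b a → r b c → dist a b < ε → dist b c < ε → dist a c < ε)
    {a b : ℝ} {l : List ℝ} (hab : dist a b < ε) (hchain : IsEpsChain ε (b :: l))
    (hl : (b :: l).IsChain r) :
    ∃ l', chainClass ε (a :: b :: l) = chainClass ε (a :: l') ∧ IsEpsChain ε (a :: l') ∧
      (a :: l').getLast? = (b :: l).getLast? ∧
      ((a :: l').IsChain r ∨ (a :: l').IsChain (flip r)) := by
  have hcons : IsEpsChain ε (a :: b :: l) := ⟨by simp, List.isChain_cons_cons.2 ⟨hab, hchain.2⟩⟩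
  induction l generalizing b with
  | nil =>
    rcases trichotomous_of r a b with h | rfl | h
    · exact ⟨[b], rfl, hcons, rfl, .inl (by simpa)⟩
    · exact ⟨[], chainClass_dup ε [] [] a, hchain, rfl, .inl hl⟩
    · exact ⟨[b], rfl, hcons, rfl, .inr (by simpa)⟩
  | cons c l ih =>
    rcases trichotomous_of r a b with h | rfl | h
    · exact ⟨b :: c :: l, rfl, hcons, rfl, .inl (List.isChain_cons_cons.2 ⟨h, hl⟩)⟩
    · exact ⟨c :: l, chainClass_dup ε [] _ a, hchain, rfl, .inl hl⟩
    · -- The chain turns back at `b`, so that `b` can be skipped.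
      have ⟨hbc, hchain'⟩ := List.isChain_cons_cons.1 hchain.2
      have ⟨hrbc, hl'⟩ := List.isChain_cons_cons.1 hl
      have hac : dist a c < ε := hr h hrbc hab hbc
      obtain ⟨l', heq, h'⟩ := ih hac ⟨by simp, hchain'⟩ hl'
        ⟨by simp, List.isChain_cons_cons.2 ⟨hac, hchain'⟩⟩
      exact ⟨l', (chainClass_skip [] l hab hbc hac).trans heq, h'⟩

theorem exists_chainClass_eq_isChain_lt_or_gt {a : ℝ} {l : List ℝ} (h : IsEpsChain ε (a :: l)) :
    ∃ l', chainClass ε (a :: l) = chainClass ε (a :: l') ∧ IsEpsChain ε (a :: l') ∧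
      (a :: l').getLast? = (a :: l).getLast? ∧
      ((a :: l').IsChain (· < ·) ∨ (a :: l').IsChain (· > ·)) := by
  induction l generalizing a with
  | nil => exact ⟨[], rfl, h, rfl, .inl (by simp)⟩
  | cons b l ih =>
    have ⟨hab, hchain⟩ := List.isChain_cons_cons.1 h.2
    obtain ⟨l₁, heq₁, hchain₁, hlast₁, hl₁⟩ := ih ⟨by simp, hchain⟩
    obtain ⟨l₂, heq₂, hchain₂, hlast₂, hl₂⟩ : ∃ l', chainClass ε (a :: b :: l₁) =
        chainClass ε (a :: l') ∧ IsEpsChain ε (a :: l') ∧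
        (a :: l').getLast? = (b :: l₁).getLast? ∧
        ((a :: l').IsChain (· < ·) ∨ (a :: l').IsChain (· > ·)) := by
      rcases hl₁ with hl₁ | hl₁
      · refine exists_chainClass_cons_eq_of_isChain (fun h₁ h₂ h₃ h₄ => ?_) hab hchain₁ hl₁
        rw [Real.dist_eq, abs_lt] at *
        constructor <;> linarith
      · refine (exists_chainClass_cons_eq_of_isChain (fun h₁ h₂ h₃ h₄ => ?_) hab hchain₁ hl₁).imp
          fun _ h => ⟨h.1, h.2.1, h.2.2.1, h.2.2.2.symm⟩
        rw [Real.dist_eq, abs_lt] at *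
        constructor <;> linarith
    refine ⟨l₂, ?_, hchain₂, by simpa [hlast₁] using hlast₂, hl₂⟩
    rw [← heq₂, chainClass_cons, heq₁, ← chainClass_cons]

theorem eq_nil_of_isChain_of_getLast?_eq {ι : Type*} {r : ι → ι → Prop} [IsTrans ι r]
    [Std.Irrefl r] {a : ι} {l : List ι} (h : (a :: l).IsChain r)
    (hlast : (a :: l).getLast? = some a) : l = [] := by
  rcases List.eq_nil_or_concat l with rfl | ⟨l, b, rfl⟩
  · rfl
  · obtain rfl : b = a := by simpa [List.getLast?_cons] using hlast
    exact absurd ((List.pairwise_cons.1 h.pairwise).1 b (by simp)) (irrefl b)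

theorem chainClass_real_loop {a : ℝ} {σ : List ℝ} (hσ : IsEpsChainFromTo ε a a σ) :
    chainClass ε σ = chainClass ε [a] := by
  obtain ⟨l, rfl⟩ := List.head?_eq_some_iff.1 hσ.head?_eq
  obtain ⟨l', heq, -, hlast, hl'⟩ := exists_chainClass_eq_isChain_lt_or_gt hσ.isEpsChain
  rw [hσ.getLast?_eq] at hlast
  obtain rfl : l' = [] := by
    rcases hl' with hl' | hl' <;> exact eq_nil_of_isChain_of_getLast?_eq hl' hlast
  exact heq

theorem chainClass_real_eq (hε : 0 < ε) {a b : ℝ} {σ τ : List ℝ}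
    (hσ : IsEpsChainFromTo ε a b σ) (hτ : IsEpsChainFromTo ε a b τ) :
    chainClass ε σ = chainClass ε τ :=
  calc chainClass ε σ = chainClass ε σ * (chainClass ε τ.reverse * chainClass ε τ) := by
        rw [hτ.chainClass_reverse_mul, hσ.chainClass_mul_singleton]
    _ = chainClass ε (σ ++ τ.reverse) * chainClass ε τ := by rw [chainClass_append, mul_assoc]
    _ = chainClass ε τ := by
        rw [chainClass_real_loop (hσ.append hε hτ.reverse), hτ.chainClass_singleton_mul]

/-! ### Essential circles carry critical loops -/

variable {c : ℝ → X}

/-- The chain of the parameters `0`, `3ε/4`, `3ε/2`, `9ε/4`, `3ε`. Its image under an arclength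
parameterized loop of length `3ε` goes once around the loop. -/
noncomputable def circuit (ε : ℝ) : List ℝ := [0, 3 * ε / 4, 3 * ε / 2, 9 * ε / 4, 3 * ε]

theorem isEpsChainFromTo_circuit (hε : 0 < ε) (hδ : ε ≤ δ) :
    IsEpsChainFromTo δ 0 (3 * ε) (circuit ε) := by
  refine ⟨⟨by simp [circuit], ?_⟩, rfl, rfl⟩
  simp only [circuit, List.isChain_cons_cons, List.isChain_singleton, and_true, Real.dist_eq,
    abs_lt]
  refine ⟨⟨?_, ?_⟩, ⟨?_, ?_⟩, ⟨?_, ?_⟩, ?_, ?_⟩ <;> linarith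

theorem chainClass_map_circuit_of_lt (hc : LipschitzWith 1 c) (hloop : c 0 = c (3 * ε))
    (hε : 0 < ε) (hδ : ε < δ) : chainClass δ ((circuit ε).map c) = chainClass δ [c 0] := by
  have hthree : IsEpsChainFromTo δ 0 (3 * ε) [0, ε, 2 * ε, 3 * ε] := by
    refine ⟨⟨by simp, ?_⟩, rfl, rfl⟩
    simp only [List.isChain_cons_cons, List.isChain_singleton, and_true, Real.dist_eq, abs_lt]
    refine ⟨⟨?_, ?_⟩, ⟨?_, ?_⟩, ?_, ?_⟩ <;> linarith
  have hdist : ∀ {s t}, t - s = ε → dist (c s) (c t) < δ := fun h =>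
    dist_lt_of_lipschitzWith_one hc (by rwa [dist_comm, Real.dist_eq, h, abs_of_pos hε])
  have h₁ : dist (c 0) (c ε) < δ := hdist (by ring)
  have h₂ : dist (c ε) (c (2 * ε)) < δ := hdist (by ring)
  have h₃ : dist (c (2 * ε)) (c 0) < δ := hloop ▸ hdist (by ring)
  calc chainClass δ ((circuit ε).map c)
    _ = chainClass δ [c 0, c ε, c (2 * ε), c (3 * ε)] := chainClass_map_eq hc
        (chainClass_real_eq (hε.trans hδ) (isEpsChainFromTo_circuit hε hδ.le) hthree)
    _ = chainClass δ [c 0, c ε, c (2 * ε), c 0] := by rw [← hloop]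
    _ = chainClass δ [c 0, c ε, c 0] :=
        chainClass_skip [c 0] [] h₂ h₃ (by rwa [dist_comm])
    _ = chainClass δ [c 0] := chainClass_spur [] [] h₁

theorem exists_lift_chord_of_near (hc : LipschitzWith 1 c) {s t : ℝ} (hst : |s - t| < 2 * ε)
    (hd : dist (c s) (c t) < ε) :
    ∃ σ, IsEpsChainFromTo ε s t σ ∧ chainClass ε (σ.map c) = chainClass ε [c s, c t] := by
  have hsm : dist s ((s + t) / 2) < ε := by
    rw [Real.dist_eq, show s - (s + t) / 2 = (s - t) / 2 by ring, abs_div, abs_two]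
    linarith
  have hmt : dist ((s + t) / 2) t < ε := by
    rw [Real.dist_eq, show (s + t) / 2 - t = (s - t) / 2 by ring, abs_div, abs_two]
    linarith
  exact ⟨[s, (s + t) / 2, t], ⟨⟨by simp, by simp [hsm, hmt]⟩, rfl, rfl⟩,
    chainClass_skip [] [] (dist_lt_of_lipschitzWith_one hc hsm)
      (dist_lt_of_lipschitzWith_one hc hmt) hd⟩

theorem exists_lift_chord_of_null (hc : LipschitzWith 1 c) (hε : 0 < ε) {p q s t : ℝ}
    {ω : List ℝ} (hω : IsEpsChainFromTo ε p q ω) (hpq : c p = c q)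
    (hnull : chainClass ε (ω.map c) = chainClass ε [c p]) (hlen : |s - p| + |q - t| ≤ ε)
    (hd : dist (c s) (c t) < ε) :
    ∃ σ, IsEpsChainFromTo ε s t σ ∧ chainClass ε (σ.map c) = chainClass ε [c s, c t] := by
  have hsp : dist (c s) (c p) ≤ |s - p| := by simpa [Real.dist_eq] using hc.dist_le_mul s p
  have hqt : dist (c p) (c t) ≤ |q - t| := by
    simpa [Real.dist_eq, hpq] using hc.dist_le_mul q t
  have hsp' : dist (c s) (c p) < ε := by
    linarith [dist_triangle_right (c s) (c p) (c t)]
  have hqt' : dist (c p) (c t) < ε := by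
    linarith [dist_triangle_left (c p) (c t) (c s)]
  obtain ⟨σ, hσ, hσc⟩ := exists_lift_chord_of_near hc
    (by linarith [abs_nonneg (q - t)] : |s - p| < 2 * ε) hsp'
  obtain ⟨τ, hτ, hτc⟩ := exists_lift_chord_of_near hc
    (by linarith [abs_nonneg (s - p)] : |q - t| < 2 * ε) (hpq ▸ hqt')
  -- The lift goes around the null circuit, since `s` and `t` may be far apart on the line.
  refine ⟨σ ++ ω ++ τ, (hσ.append hε hω).append hε hτ, ?_⟩
  calc chainClass ε ((σ ++ ω ++ τ).map c)
    _ = chainClass ε [c s, c p, c p, c p, c t] := by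
        rw [List.map_append, List.map_append, chainClass_append, chainClass_append, hσc, hnull,
          hτc, ← hpq]
        rfl
    _ = chainClass ε [c s, c p, c p, c t] := chainClass_dup ε [c s] [c p, c t] (c p)
    _ = chainClass ε [c s, c p, c t] := chainClass_dup ε [c s] [c t] (c p)
    _ = chainClass ε [c s, c t] := chainClass_skip [] [] hsp' hqt' hd

theorem exists_lift_chord (hc : LipschitzWith 1 c) (hloop : c 0 = c (3 * ε)) (hε : 0 < ε)
    (hnull : chainClass ε ((circuit ε).map c) = chainClass ε [c 0]) {s t : ℝ}
    (hs : s ∈ Set.Icc 0 (3 * ε)) (ht : t ∈ Set.Icc 0 (3 * ε)) (hd : dist (c s) (c t) < ε) :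
    ∃ σ, IsEpsChainFromTo ε s t σ ∧ chainClass ε (σ.map c) = chainClass ε [c s, c t] := by
  have hω := isEpsChainFromTo_circuit hε le_rfl
  have hωc : IsEpsChainFromTo ε (c 0) (c 0) ((circuit ε).map c) := by
    simpa only [← hloop] using hω.map hc
  have habs : ∀ s' ∈ Set.Icc 0 (3 * ε), ∀ t' ∈ Set.Icc 0 (3 * ε), 2 * ε ≤ t' - s' →
      |s' - 0| + |3 * ε - t'| ≤ ε := fun s' hs' t' ht' h => by
    rw [sub_zero, abs_of_nonneg hs'.1, abs_of_nonneg (by linarith [ht'.2])]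
    linarith
  rcases lt_or_ge |s - t| (2 * ε) with hst | hst
  · exact exists_lift_chord_of_near hc hst hd
  rcases le_abs.1 hst with hts | hst
  · refine exists_lift_chord_of_null hc hε hω.reverse hloop.symm ?_ ?_ hd
    · rw [List.map_reverse, ← hloop]
      exact hωc.chainClass_reverse_of_null hnull
    · rw [add_comm, abs_sub_comm s, abs_sub_comm 0]
      exact habs t ht s hs hts
  · exact exists_lift_chord_of_null hc hε hω hloop hnull (habs s hs t ht (by linarith)) hd

theorem exists_lift_of_exists_lift_chord (hε : 0 < ε) {C : Set X} {g : X → ℝ}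
    (hchord : ∀ x ∈ C, ∀ y ∈ C, dist x y < ε →
      ∃ σ, IsEpsChainFromTo ε (g x) (g y) σ ∧ chainClass ε (σ.map c) = chainClass ε [x, y])
    (hg : ∀ x ∈ C, c (g x) = x) (hα : IsEpsChainFromTo ε x y α) (hαC : ∀ z ∈ α, z ∈ C) :
    ∃ σ, IsEpsChainFromTo ε (g x) (g y) σ ∧ chainClass ε (σ.map c) = chainClass ε α := by
  obtain ⟨⟨-, hchain⟩, hx, hy⟩ := hα
  induction α generalizing x with
  | nil => simp at hx
  | cons a l ih =>
    obtain rfl : a = x := by simpa using hx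
    rw [List.forall_mem_cons] at hαC
    cases l with
    | nil =>
      obtain rfl : a = y := by simpa using hy
      exact ⟨[g a], ⟨⟨by simp, by simp⟩, rfl, rfl⟩, by simp [hg a hαC.1]⟩
    | cons b l =>
      rw [List.isChain_cons_cons] at hchain
      obtain ⟨σ, hσ, hσc⟩ := hchord a hαC.1 b (hαC.2 b (by simp)) hchain.1
      obtain ⟨τ, hτ, hτc⟩ := ih hαC.2 rfl hy hchain.2
      refine ⟨σ ++ τ, hσ.append hε hτ, ?_⟩
      rw [List.map_append, chainClass_append, hσc, hτc]
      exact chainClass_dup ε [a] l b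

theorem isEpsNull_of_circuit_null (hc : LipschitzWith 1 c) (hloop : c 0 = c (3 * ε))
    (hε : 0 < ε) (hnull : chainClass ε ((circuit ε).map c) = chainClass ε [c 0])
    (hα : IsEpsLoop ε α) (hαC : ∀ x ∈ α, x ∈ c '' Set.Icc 0 (3 * ε)) : IsEpsNull ε α := by
  obtain ⟨x, hx⟩ := hα.exists_isEpsChainFromTo
  have hxC : x ∈ c '' Set.Icc 0 (3 * ε) := hαC x (List.mem_of_head? hx.head?_eq)
  choose! g hgI hg using fun x (hx : x ∈ c '' Set.Icc 0 (3 * ε)) => hx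
  obtain ⟨σ, hσ, hσc⟩ := exists_lift_of_exists_lift_chord hε (fun x hx y hy hxy => by
    simpa only [hg x hx, hg y hy] using exists_lift_chord hc hloop hε hnull (hgI x hx) (hgI y hy)
      (by rwa [hg x hx, hg y hy])) hg hx hαC
  rw [hx.isEpsNull_iff hε, ← hσc, chainClass_map_eq hc (chainClass_real_loop hσ),
    List.map_singleton, hg x hxC]

theorem dist_le_of_hasUnitSpeedOn {L s t : ℝ} (h : HasUnitSpeedOn c (Set.Icc 0 L))
    (hs : s ∈ Set.Icc 0 L) (ht : t ∈ Set.Icc 0 L) : dist (c s) (c t) ≤ dist s t := by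
  wlog hst : s ≤ t generalizing s t
  · simpa only [dist_comm] using this ht hs (le_of_not_ge hst)
  rw [dist_comm s, Real.dist_eq, abs_of_nonneg (sub_nonneg.2 hst),
    ← ENNReal.ofReal_le_ofReal_iff (sub_nonneg.2 hst), ← edist_dist]
  simpa [h hs ht] using eVariationOn.edist_le c (s := Set.Icc 0 L ∩ Set.Icc s t)
    ⟨hs, Set.left_mem_Icc.2 hst⟩ ⟨ht, Set.right_mem_Icc.2 hst⟩

theorem IsArclengthLoop.exists_lipschitzWith {L : ℝ} (hL : 0 ≤ L) (h : IsArclengthLoop L c) :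
    ∃ f : ℝ → X, LipschitzWith 1 f ∧ f 0 = f L ∧ f '' Set.Icc 0 L = c '' Set.Icc 0 L := by
  have hext : ∀ t ∈ Set.Icc 0 L, Set.IccExtend hL ((Set.Icc 0 L).domRestrict c) t = c t :=
    fun t ht => Set.IccExtend_of_mem hL _ ht
  refine ⟨Set.IccExtend hL ((Set.Icc 0 L).domRestrict c), .of_dist_le_mul fun s t => ?_, ?_,
    Set.image_congr hext⟩
  · rw [NNReal.coe_one, one_mul]
    exact (dist_le_of_hasUnitSpeedOn h.1 (Set.projIcc 0 L hL s).2 (Set.projIcc 0 L hL t).2).trans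
      (Set.abs_projIcc_sub_projIcc hL)
  · rw [hext 0 ⟨le_rfl, hL⟩, hext L ⟨hL, le_rfl⟩, h.2]

theorem isHomotopyCriticalValue_of_isEssentialCircle (hε : 0 < ε) {C : Set X}
    (hC : IsEssentialCircle ε C) : IsHomotopyCriticalValue X ε := by
  obtain ⟨⟨c, hc, rfl⟩, α, hα, hαC, hnot⟩ := hC
  obtain ⟨f, hf, hloop, himage⟩ := hc.exists_lipschitzWith (by positivity)
  rw [← himage] at hαC
  have hcircuit : ∀ {δ}, ε ≤ δ → IsEpsChainFromTo δ (f 0) (f 0) ((circuit ε).map f) :=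
    fun hδ => by simpa only [← hloop] using (isEpsChainFromTo_circuit hε hδ).map hf
  refine ⟨(circuit ε).map f, (hcircuit le_rfl).isEpsLoop, fun h => hnot ?_, fun δ hδ => ?_⟩
  · exact isEpsNull_of_circuit_null hf hloop hε (((hcircuit le_rfl).isEpsNull_iff hε).1 h) hα hαC
  · exact ((hcircuit hδ.le).isEpsNull_iff (hε.trans hδ)).2
      (chainClass_map_circuit_of_lt hf hloop hε hδ)

/-! ### Hexagons -/

variable {v w : Fin 6 → X}

/-- The closed sequence of points that goes once around the hexagon with vertices `w 0`, …,
`w 5`. Subdividing a triangle at the midpoints of its sides gives such a hexagon. -/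
def hexagon (w : Fin 6 → X) : List X := [0, 1, 2, 3, 4, 5, 0].map w

theorem isEpsChainFromTo_hexagon (hw : ∀ i, dist (w i) (w (i + 1)) < ε) :
    IsEpsChainFromTo ε (w 0) (w 0) (hexagon w) := by
  refine ⟨⟨by simp [hexagon], ?_⟩, rfl, rfl⟩
  simp only [hexagon, List.map_cons, List.map_nil, List.isChain_cons_cons, List.isChain_singleton,
    and_true]
  exact ⟨hw 0, hw 1, hw 2, hw 3, hw 4, hw 5⟩

theorem chainClass_ladder {ι : Type*} {v w : ι → X} (l : List ι) (i : ι)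
    (hrung : ∀ j ∈ i :: l, dist (v j) (w j) < ε)
    (hstep : (i :: l).IsChain fun j k =>
      dist (v j) (v k) < ε ∧ dist (w j) (w k) < ε ∧ dist (v j) (w k) < ε) :
    chainClass ε ((i :: l).map v) * chainClass ε [w ((i :: l).getLast (by simp))] =
      chainClass ε [v i] * chainClass ε ((i :: l).map w) := by
  induction l generalizing i with
  | nil => rfl
  | cons j l ih =>
    obtain ⟨⟨hv, hw, hvw⟩, hstep⟩ := List.isChain_cons_cons.1 hstep
    rw [List.forall_mem_cons] at hrung
    calc chainClass ε ((i :: j :: l).map v) *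
          chainClass ε [w ((i :: j :: l).getLast (by simp))]
      _ = chainClass ε (v i :: v j :: w j :: l.map w) := by
          rw [List.map_cons, chainClass_cons, mul_assoc, List.getLast_cons_cons,
            ih j hrung.2 hstep]
          rfl
      _ = chainClass ε (v i :: w j :: l.map w) :=
          chainClass_skip [] _ hv (hrung.2 j (by simp)) hvw
      _ = chainClass ε (v i :: w i :: w j :: l.map w) :=
          (chainClass_skip [] _ hrung.1 hw hvw).symm

theorem chainClass_hexagon_of_near (hd : ∀ i, dist (v i) (w i) < ε / 4)
    (hw : ∀ i, dist (w i) (w (i + 1)) ≤ ε / 2)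
    (hnull : chainClass ε (hexagon w) = chainClass ε [w 0]) :
    chainClass ε (hexagon v) = chainClass ε [v 0] := by
  have hrung : ∀ i, dist (v i) (w i) < ε := fun i => by
    linarith [hd i, dist_nonneg.trans_lt (hd i)]
  have hstep : ∀ i, dist (v i) (v (i + 1)) < ε ∧ dist (w i) (w (i + 1)) < ε ∧
      dist (v i) (w (i + 1)) < ε := fun i => by
    have hε : 0 < ε / 4 := dist_nonneg.trans_lt (hd i)
    have hvw := dist_triangle (v i) (w i) (w (i + 1))
    have hvv := dist_triangle_right (v i) (v (i + 1)) (w (i + 1))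
    refine ⟨?_, ?_, ?_⟩ <;> linarith [hd i, hd (i + 1), hw i]
  have hladder : chainClass ε (hexagon v) * chainClass ε [w 0] =
      chainClass ε [v 0] * chainClass ε (hexagon w) := by
    refine chainClass_ladder [1, 2, 3, 4, 5, 0] 0 (fun i _ => hrung i) ?_
    simp only [List.isChain_cons_cons, List.isChain_singleton, and_true]
    exact ⟨hstep 0, hstep 1, hstep 2, hstep 3, hstep 4, hstep 5⟩
  calc chainClass ε (hexagon v)
    _ = chainClass ε (hexagon v) * chainClass ε [w 0] * chainClass ε [v 0] :=
        (chainClass_spur [v 0, v 1, v 2, v 3, v 4, v 5] [] (hrung 0)).symm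
    _ = chainClass ε [v 0, w 0, v 0] := by rw [hladder, hnull]; rfl
    _ = chainClass ε [v 0] := chainClass_spur [] [] (hrung 0)

theorem chainClass_hexagon_rotate_one (hw : ∀ i, dist (w i) (w (i + 1)) < ε)
    (hnull : chainClass ε (hexagon w) = chainClass ε [w 0]) :
    chainClass ε (hexagon fun j => w (j + 1)) = chainClass ε [w 1] := by
  have h₁₀ : dist (w 1) (w 0) < ε := by rw [dist_comm]; exact hw 0
  calc chainClass ε (hexagon fun j => w (j + 1))
    _ = chainClass ε [w 1, w 2, w 3, w 4, w 5, w 0, w 1] := rfl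
    _ = chainClass ε [w 1, w 0, w 1, w 2, w 3, w 4, w 5, w 0, w 1] :=
        (chainClass_spur [] _ h₁₀).symm
    _ = chainClass ε [w 1] * chainClass ε (hexagon w) * chainClass ε [w 1] := rfl
    _ = chainClass ε [w 1, w 0, w 1] := by rw [hnull]; rfl
    _ = chainClass ε [w 1] := chainClass_spur [] [] h₁₀

open Fin.CommRing in
theorem chainClass_hexagon_rotate (hw : ∀ i, dist (w i) (w (i + 1)) < ε) (i : Fin 6)
    (hnull : chainClass ε (hexagon w) = chainClass ε [w 0]) :
    chainClass ε (hexagon fun j => w (j + i)) = chainClass ε [w i] := by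
  suffices h : ∀ n : ℕ, chainClass ε (hexagon fun j => w (j + n)) = chainClass ε [w n] by
    simpa using h i.val
  intro n
  induction n with
  | zero => simpa using hnull
  | succ n ih =>
    have := chainClass_hexagon_rotate_one (w := fun j => w (j + n)) (ε := ε)
      (fun j => by simpa only [add_right_comm] using hw (j + n)) (by simpa using ih)
    simpa only [Nat.cast_add, Nat.cast_one, add_assoc, add_comm (1 : Fin 6)] using this

theorem chainClass_triangle_of_hexagon {a b c p q r : X}
    (hw : ∀ i, dist (![a, p, b, q, c, r] i) (![a, p, b, q, c, r] (i + 1)) < ε)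
    (hnull : chainClass ε (hexagon ![a, p, b, q, c, r]) = chainClass ε [a]) :
    chainClass ε [a, p, b, q, c] = chainClass ε [a, r, c] :=
  calc chainClass ε [a, p, b, q, c]
    _ = chainClass ε [a, p, b, q, c, r, c] := (chainClass_spur [a, p, b, q] [] (hw 4)).symm
    _ = chainClass ε [a, p, b, q, c, r, a, r, c] :=
        (chainClass_spur [a, p, b, q, c] [c] (hw 5)).symm
    _ = chainClass ε (hexagon ![a, p, b, q, c, r]) * chainClass ε [r, c] := rfl
    _ = chainClass ε [a, r, c] := by rw [hnull]; rfl

/-! ### Subdividing chains -/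

/-- The sequence with the points `μ x y` inserted between consecutive points `x`, `y`. -/
def subdivide {X : Type*} (μ : X → X → X) : List X → List X
  | [] => []
  | [x] => [x]
  | x :: y :: α => x :: μ x y :: subdivide μ (y :: α)

section Subdivide

variable {μ : X → X → X}

theorem chainClass_singleton_mul_subdivide (ε : ℝ) (μ : X → X → X) (x : X) (α : List X) :
    chainClass ε [x] * chainClass ε (subdivide μ (x :: α)) =
      chainClass ε (subdivide μ (x :: α)) := by
  cases α with
  | nil => exact chainClass_dup ε [] [] x
  | cons y α => exact chainClass_dup ε [] _ x

theorem chainClass_subdivide_append (ε : ℝ) (μ : X → X → X) (l r : List X) (x : X) :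
    chainClass ε (subdivide μ (l ++ x :: r)) =
      chainClass ε (subdivide μ (l ++ [x])) * chainClass ε (subdivide μ (x :: r)) := by
  induction l with
  | nil => exact (chainClass_singleton_mul_subdivide ε μ x r).symm
  | cons y l ih =>
    have hcons : ∀ z s, chainClass ε (subdivide μ (y :: z :: s)) =
        chainClass ε [y, μ y z] * chainClass ε (subdivide μ (z :: s)) := fun _ _ => rfl
    cases l with
    | nil =>
      simp only [List.cons_append, List.nil_append] at ih ⊢
      rw [hcons, hcons, mul_assoc, ← ih]
    | cons z l =>
      simp only [List.cons_append] at ih ⊢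
      rw [hcons, hcons, mul_assoc, ← ih]

theorem chainClass_subdivide
    (hμ : ∀ x y, dist x y < ε → dist x (μ x y) < ε ∧ dist (μ x y) y < ε)
    (hα : α.IsChain fun x y => dist x y < ε) :
    chainClass ε (subdivide μ α) = chainClass ε α := by
  induction α with
  | nil => rfl
  | cons x α ih =>
    cases α with
    | nil => rfl
    | cons y α =>
      rw [List.isChain_cons_cons] at hα
      obtain ⟨hxμ, hμy⟩ := hμ x y hα.1
      calc chainClass ε (subdivide μ (x :: y :: α))
        _ = chainClass ε [x, μ x y] * chainClass ε (subdivide μ (y :: α)) := rfl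
        _ = chainClass ε (x :: μ x y :: y :: α) := by rw [ih hα.2]; rfl
        _ = chainClass ε (x :: y :: α) :=
            chainClass_skip [] α hxμ hμy hα.1

theorem chainClass_subdivide_dup (ε : ℝ) (l r : List X) {x : X} (hx : μ x x = x) :
    chainClass ε (subdivide μ (l ++ x :: x :: r)) = chainClass ε (subdivide μ (l ++ x :: r)) := by
  have hxx : chainClass ε (subdivide μ (x :: x :: r)) = chainClass ε (subdivide μ (x :: r)) :=
    calc chainClass ε (subdivide μ (x :: x :: r))
      _ = chainClass ε [x] * (chainClass ε [x] * chainClass ε (subdivide μ (x :: r))) := by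
          rw [subdivide, hx]; rfl
      _ = chainClass ε (subdivide μ (x :: r)) := by
          rw [chainClass_singleton_mul_subdivide, chainClass_singleton_mul_subdivide]
  rw [chainClass_subdivide_append, hxx, ← chainClass_subdivide_append]

theorem chainClass_subdivide_skip (l r : List X) {x y z : X}
    (h : chainClass ε [x, μ x y, y, μ y z, z] = chainClass ε [x, μ x z, z]) :
    chainClass ε (subdivide μ (l ++ x :: y :: z :: r)) =
      chainClass ε (subdivide μ (l ++ x :: z :: r)) := by
  have hxyz : chainClass ε (subdivide μ (x :: y :: z :: r)) =
      chainClass ε (subdivide μ (x :: z :: r)) :=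
    calc chainClass ε (subdivide μ (x :: y :: z :: r))
      _ = chainClass ε [x, μ x y, y, μ y z] *
          (chainClass ε [z] * chainClass ε (subdivide μ (z :: r))) := by
          rw [chainClass_singleton_mul_subdivide]; rfl
      _ = chainClass ε [x, μ x y, y, μ y z, z] * chainClass ε (subdivide μ (z :: r)) := rfl
      _ = chainClass ε [x, μ x z] *
          (chainClass ε [z] * chainClass ε (subdivide μ (z :: r))) := by rw [h]; rfl
      _ = chainClass ε (subdivide μ (x :: z :: r)) := by
          rw [chainClass_singleton_mul_subdivide]; rfl
  rw [chainClass_subdivide_append, hxyz, ← chainClass_subdivide_append]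

theorem exists_hexagon_not_null
    (hμ : ∀ x y, dist x (μ x y) = dist x y / 2 ∧ dist (μ x y) y = dist x y / 2) (hε : 0 < ε)
    (hδ : δ ≤ 2 * ε) (hα : IsEpsLoop ε α) (hnot : ¬ IsEpsNull ε α) (hnull : IsEpsNull δ α) :
    ∃ w : Fin 6 → X, (∀ i, dist (w i) (w (i + 1)) < δ / 2) ∧
      chainClass ε (hexagon w) ≠ chainClass ε [w 0] := by
  by_contra! hfill
  obtain ⟨-, x, hx, h⟩ := hnull
  refine hnot ⟨hα, x, hx, (epsHomotopic_iff hε hα.1).2 ?_⟩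
  have hμ_lt : ∀ x y, dist x y < ε → dist x (μ x y) < ε ∧ dist (μ x y) y < ε := fun x y hxy => by
    constructor <;> linarith [hμ x y, dist_nonneg (x := x) (y := y)]
  have hμ_self : ∀ x, μ x x = x := fun x => dist_eq_zero.1 (by simpa using (hμ x x).2)
  rw [← chainClass_subdivide hμ_lt hα.1.2]
  refine h.map_eq (f := fun β => chainClass ε (subdivide μ β))
    (fun l r x => chainClass_subdivide_dup ε l r (hμ_self x))
    fun l r a b c hab hbc hac => chainClass_subdivide_skip l r ?_
  have hw : ∀ i, dist (![a, μ a b, b, μ b c, c, μ a c] i)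
      (![a, μ a b, b, μ b c, c, μ a c] (i + 1)) < δ / 2 := by
    obtain ⟨hab₁, hab₂⟩ := hμ a b
    obtain ⟨hbc₁, hbc₂⟩ := hμ b c
    obtain ⟨hac₁, hac₂⟩ := hμ a c
    rw [dist_comm] at hac₁ hac₂
    simp only [Fin.forall_fin_succ, IsEmpty.forall_iff, and_true]
    refine ⟨?_, ?_, ?_, ?_, ?_, ?_⟩
    · exact hab₁.trans_lt (by linarith)
    · exact hab₂.trans_lt (by linarith)
    · exact hbc₁.trans_lt (by linarith)
    · exact hbc₂.trans_lt (by linarith)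
    · exact hac₂.trans_lt (by linarith)
    · exact hac₁.trans_lt (by linarith)
  exact chainClass_triangle_of_hexagon (fun i => (hw i).trans_le (by linarith)) (hfill _ hw)

end Subdivide

/-! ### Critical loops give regular hexagons -/

theorem IsGeodesicSpace.exists_dist_eq (hX : IsGeodesicSpace X) {s : ℝ}
    (hs : s ∈ Set.Icc 0 (dist x y)) : ∃ p, dist x p = s ∧ dist p y = dist x y - s := by
  obtain ⟨γ, rfl, hy, hγ⟩ := hX x y
  refine ⟨γ s, ?_, ?_⟩
  · rw [hγ 0 ⟨le_rfl, dist_nonneg⟩ s hs, zero_sub, abs_neg, abs_of_nonneg hs.1]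
  · nth_rw 1 [← hy]
    rw [hγ s hs _ ⟨dist_nonneg, le_rfl⟩, abs_sub_comm, abs_of_nonneg (sub_nonneg.2 hs.2)]

theorem IsGeodesicSpace.exists_dist_le_dist_le (hX : IsGeodesicSpace X) {η r : ℝ} (hη : 0 ≤ η)
    (hηr : η ≤ r) (hr : dist x y ≤ r) : ∃ p, dist x p ≤ η ∧ dist p y ≤ r - η := by
  rcases le_total η (dist x y) with h | h
  · obtain ⟨p, hxp, hpy⟩ := hX.exists_dist_eq ⟨hη, h⟩
    exact ⟨p, hxp.le, by linarith⟩
  · exact ⟨y, h, by simpa⟩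

theorem chainClass_hexagon_of_dist_lt (hX : IsGeodesicSpace X)
    (hw : ∀ i, dist (w i) (w (i + 1)) ≤ ε / 2) (hd : dist (w 0) (w 2) < ε) :
    chainClass ε (hexagon w) = chainClass ε [w 0] := by
  have hε : 0 < ε := dist_nonneg.trans_lt hd
  obtain ⟨η, hη, hηε⟩ : ∃ η, 0 < η ∧ η < ε / 2 ∧ 2 * η + dist (w 0) (w 2) < ε :=
    ⟨min (ε / 3) ((ε - dist (w 0) (w 2)) / 3), by
      have := min_le_left (ε / 3) ((ε - dist (w 0) (w 2)) / 3)
      have := min_le_right (ε / 3) ((ε - dist (w 0) (w 2)) / 3)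
      refine ⟨lt_min (by linarith) (by linarith), ?_, ?_⟩ <;> linarith⟩
  have h₀₁ : dist (w 0) (w 1) ≤ ε / 2 := hw 0
  have h₁₂ : dist (w 1) (w 2) ≤ ε / 2 := hw 1
  have h₂₃ : dist (w 2) (w 3) ≤ ε / 2 := hw 2
  have h₃₄ : dist (w 3) (w 4) ≤ ε / 2 := hw 3
  have h₄₅ : dist (w 4) (w 5) ≤ ε / 2 := hw 4
  have h₅₀ : dist (w 5) (w 0) ≤ ε / 2 := hw 5
  -- The diagonals from `w 2` to `w 4` and from `w 4` to `w 0` may have length exactly `ε`. Points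
  -- `p`, `q` on the sides, slightly off the corners `w 2`, `w 0`, give diagonals shorter than `ε`.
  obtain ⟨p, h₂p, hp₃⟩ := hX.exists_dist_le_dist_le hη.le hηε.1.le h₂₃
  obtain ⟨q, h₀q, hq₅⟩ := hX.exists_dist_le_dist_le hη.le hηε.1.le
    ((dist_comm _ _).trans_le h₅₀)
  rw [dist_comm] at h₀q hq₅
  have hp₄ := dist_triangle p (w 3) (w 4)
  have h₄q := dist_triangle (w 4) (w 5) q
  have hp₀ := dist_triangle_left p (w 0) (w 2)
  rw [dist_comm (w 2) (w 0)] at hp₀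
  have hpq := dist_triangle_right p q (w 0)
  have h₂₀ : dist (w 2) (w 0) < ε := by rwa [dist_comm]
  calc chainClass ε (hexagon w)
    _ = chainClass ε [w 0, w 2, w 3, w 4, w 5, w 0] :=
        chainClass_skip [] _ (by linarith) (by linarith) hd
    _ = chainClass ε [w 0, w 2, p, w 3, w 4, w 5, w 0] :=
        (chainClass_skip [w 0] _ (by linarith) (by linarith) (by linarith)).symm
    _ = chainClass ε [w 0, w 2, p, w 4, w 5, w 0] :=
        chainClass_skip [w 0, w 2] _ (by linarith) (by linarith) (by linarith)
    _ = chainClass ε [w 0, w 2, p, w 4, w 5, q, w 0] :=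
        (chainClass_skip [w 0, w 2, p, w 4] [] (by linarith) (by linarith) (by linarith)).symm
    _ = chainClass ε [w 0, w 2, p, w 4, q, w 0] :=
        chainClass_skip [w 0, w 2, p] _ (by linarith) (by linarith) (by linarith)
    _ = chainClass ε [w 0, w 2, p, q, w 0] :=
        chainClass_skip [w 0, w 2] _ (by linarith) (by linarith) (by linarith)
    _ = chainClass ε [w 0, w 2, p, w 0] :=
        chainClass_skip [w 0, w 2] [] (by linarith) (by linarith) (by linarith)
    _ = chainClass ε [w 0, w 2, w 0] :=
        chainClass_skip [w 0] [] (by linarith) (by linarith) h₂₀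
    _ = chainClass ε [w 0] := chainClass_spur [] [] hd

theorem dist_eq_of_hexagon_not_null (hX : IsGeodesicSpace X) (hε : 0 < ε)
    (hw : ∀ i, dist (w i) (w (i + 1)) ≤ ε / 2)
    (hnot : chainClass ε (hexagon w) ≠ chainClass ε [w 0]) (i : Fin 6) :
    dist (w i) (w (i + 1)) = ε / 2 := by
  have hrotate : ∀ j, dist (w (j + i)) (w (j + 1 + i)) ≤ ε / 2 := fun j => by
    simpa only [add_right_comm] using hw (j + i)
  have hchord : ε ≤ dist (w i) (w (2 + i)) := by
    by_contra! hd
    have := chainClass_hexagon_rotate (fun j => (hrotate j).trans_lt (half_lt_self hε)) (-i)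
      (chainClass_hexagon_of_dist_lt hX hrotate (by simpa using hd))
    exact hnot (by simpa using this)
  have h₁ := hw i
  have h₂ : dist (w (i + 1)) (w (2 + i)) ≤ ε / 2 := by
    rw [add_comm i 1]
    exact hrotate 1
  linarith [dist_triangle (w i) (w (i + 1)) (w (2 + i))]

theorem exists_hexagon_not_null_of_forall_gt [CompactSpace X] (hε : 0 < ε)
    (h : ∀ δ ∈ Set.Ioo ε (2 * ε), ∃ w : Fin 6 → X, (∀ i, dist (w i) (w (i + 1)) < δ / 2) ∧
      chainClass ε (hexagon w) ≠ chainClass ε [w 0]) :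
    ∃ w : Fin 6 → X, (∀ i, dist (w i) (w (i + 1)) ≤ ε / 2) ∧
      chainClass ε (hexagon w) ≠ chainClass ε [w 0] := by
  obtain ⟨u, -, hu, hlim⟩ := exists_seq_strictAnti_tendsto' (show ε < 2 * ε by linarith)
  choose v hv hnot using fun n => h (u n) (hu n)
  obtain ⟨w, φ, hφ, hw⟩ := SeqCompactSpace.tendsto_subseq v
  rw [tendsto_pi_nhds] at hw
  have hside : ∀ i, dist (w i) (w (i + 1)) ≤ ε / 2 := fun i =>
    le_of_tendsto_of_tendsto' ((hw i).dist (hw (i + 1)))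
      ((hlim.comp hφ.tendsto_atTop).div_const 2) fun n => (hv (φ n) i).le
  obtain ⟨n, hn⟩ := (Filter.eventually_all.2 fun i =>
    Metric.tendsto_nhds.1 (hw i) (ε / 4) (by linarith)).exists
  exact ⟨w, hside, fun hnull => hnot (φ n) (chainClass_hexagon_of_near hn hside hnull)⟩

theorem IsEpsCritical.exists_regular_hexagon_not_null [CompactSpace X]
    (hα : IsEpsCritical ε α) (hX : IsGeodesicSpace X) (hε : 0 < ε) :
    ∃ w : Fin 6 → X, (∀ i, dist (w i) (w (i + 1)) = ε / 2) ∧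
      chainClass ε (hexagon w) ≠ chainClass ε [w 0] := by
  obtain ⟨hloop, hnot, hnull⟩ := hα
  have hmid : ∀ x y : X, ∃ p, dist x p = dist x y / 2 ∧ dist p y = dist x y / 2 := fun x y => by
    simpa only [sub_half] using
      hX.exists_dist_eq ⟨div_nonneg dist_nonneg zero_le_two,
        half_le_self (dist_nonneg (x := x) (y := y))⟩
  choose μ hμ using hmid
  obtain ⟨w, hw, hwnot⟩ := exists_hexagon_not_null_of_forall_gt hε fun δ hδ =>
    exists_hexagon_not_null hμ hε hδ.2.le hloop hnot (hnull δ hδ.1)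
  exact ⟨w, dist_eq_of_hexagon_not_null hX hε hw hwnot, hwnot⟩

/-! ### Polygons as unit speed curves -/

theorem hasUnitSpeedOn_of_dist_eq {s : Set ℝ}
    (h : ∀ a ∈ s, ∀ b ∈ s, dist (c a) (c b) = |a - b|) : HasUnitSpeedOn c s := by
  rw [HasUnitSpeedOn, hasConstantSpeedOnWith_iff_ordered]
  intro a ha b hb hab
  have hlip : LipschitzOnWith 1 c (s ∩ Set.Icc a b) := .of_dist_le_mul fun t ht u hu => by
    simp [h t ht.1 u hu.1, Real.dist_eq]
  have hlength : eVariationOn id (s ∩ Set.Icc a b) ≤ ENNReal.ofReal (b - a) := by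
    simpa using ((monotone_id.monotoneOn s).eVariationOn_eq ha hb).le
  rw [NNReal.coe_one, one_mul]
  refine le_antisymm ?_ ?_
  · simpa using (hlip.comp_eVariationOn_le (Set.mapsTo_id _)).trans (by simpa using hlength)
  · rw [← abs_of_nonneg (sub_nonneg.2 hab), ← Real.dist_eq, dist_comm, Real.dist_eq, ← h a ha b hb,
      ← edist_dist]
    exact eVariationOn.edist_le c ⟨ha, le_rfl, hab⟩ ⟨hb, hab, le_rfl⟩

theorem IsGeodesicSpace.exists_piecewise_geodesic (hX : IsGeodesicSpace X) {h : ℝ} (hh : 0 < h)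
    {w : ℕ → X} (hw : ∀ n, dist (w n) (w (n + 1)) = h) :
    ∃ c : ℝ → X, (∀ n : ℕ, c (n * h) = w n) ∧
      ∀ n : ℕ, ∀ s ∈ Set.Icc (n * h) ((n + 1) * h), ∀ t ∈ Set.Icc (n * h) ((n + 1) * h),
        dist (c s) (c t) = |s - t| := by
  choose γ hγ₀ hγ₁ hγ using fun n => hX (w n) (w (n + 1))
  simp only [hw] at hγ₁ hγ
  let c : ℝ → X := fun t => γ ⌊t / h⌋₊ (t - ⌊t / h⌋₊ * h)
  have hvertex : ∀ n : ℕ, c (n * h) = w n := fun n => by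
    simp only [c, mul_div_cancel_right₀ _ hh.ne', Nat.floor_natCast, sub_self, hγ₀]
  have hedge : ∀ n : ℕ, ∀ t ∈ Set.Icc (n * h) ((n + 1) * h), c t = γ n (t - n * h) := by
    rintro n t ⟨hnt, htn⟩
    rcases htn.lt_or_eq with htn | rfl
    · have hfloor : ⌊t / h⌋₊ = n := (Nat.floor_eq_iff
        (div_nonneg ((by positivity : (0 : ℝ) ≤ n * h).trans hnt) hh.le)).2
          ⟨(le_div_iff₀ hh).2 hnt, (div_lt_iff₀ hh).2 htn⟩
      simp only [c, hfloor]
    · rw [← Nat.cast_add_one, hvertex, ← hγ₁]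
      congr 1
      push_cast
      ring
  refine ⟨c, hvertex, fun n s hs t ht => ?_⟩
  rw [hedge n s hs, hedge n t ht, hγ n _ ⟨by linarith [hs.1], by linarith [hs.2]⟩ _
    ⟨by linarith [ht.1], by linarith [ht.2]⟩, sub_sub_sub_cancel_right]

theorem hasUnitSpeedOn_Icc_of_piecewise {h : ℝ}
    (hc : ∀ n : ℕ, HasUnitSpeedOn c (Set.Icc (n * h) ((n + 1) * h))) (n : ℕ) :
    HasUnitSpeedOn c (Set.Icc 0 (n * h)) := by
  induction n with
  | zero => exact hasConstantSpeedOnWith_of_subsingleton _ (by simp) _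
  | succ n ih =>
    rw [Nat.cast_succ]
    exact HasConstantSpeedOnWith.Icc_Icc ih (hc n)

open Fin.CommRing in
theorem exists_isEssentialCircle_of_hexagon (hX : IsGeodesicSpace X) (hε : 0 < ε)
    (hw : ∀ i, dist (w i) (w (i + 1)) = ε / 2)
    (hnot : chainClass ε (hexagon w) ≠ chainClass ε [w 0]) :
    ∃ C : Set X, IsEssentialCircle ε C := by
  obtain ⟨c, hvertex, hc⟩ := hX.exists_piecewise_geodesic (half_pos hε) (w := fun n : ℕ => w n)
    fun n => by simpa using hw n
  have hlen : ((6 : ℕ) : ℝ) * (ε / 2) = 3 * ε := by push_cast; ring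
  have hspeed : HasUnitSpeedOn c (Set.Icc 0 (3 * ε)) := by
    simpa only [hlen] using
      hasUnitSpeedOn_Icc_of_piecewise (fun n => hasUnitSpeedOn_of_dist_eq (hc n)) 6
  have hclosed : c 0 = c (3 * ε) := by
    have h₀ := hvertex 0
    have h₆ := hvertex 6
    rw [hlen] at h₆
    rw [Nat.cast_zero, zero_mul] at h₀
    exact h₀.trans h₆.symm
  have hmem : ∀ i, w i ∈ c '' Set.Icc 0 (3 * ε) := fun i => by
    have hi : (i.val : ℝ) ≤ (6 : ℕ) := Nat.cast_le.2 i.isLt.le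
    refine ⟨i.val * (ε / 2), ⟨by positivity, ?_⟩, by simpa using hvertex i.val⟩
    exact (mul_le_mul_of_nonneg_right hi (half_pos hε).le).trans_eq hlen
  have hchain := isEpsChainFromTo_hexagon fun i => (hw i).trans_lt (half_lt_self hε)
  exact ⟨c '' Set.Icc 0 (3 * ε), ⟨c, ⟨hspeed, hclosed⟩, rfl⟩, hexagon w, hchain.isEpsLoop,
    by simp [hexagon, -Set.mem_image, hmem], mt (hchain.isEpsNull_iff hε).1 hnot⟩

end DiscreteHomotopy

theorem theorem1p4 {X : Type*} [MetricSpace X] [CompactSpace X]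
    (hX : DiscreteHomotopy.IsGeodesicSpace X) (ε : ℝ) (hε : 0 < ε) :
    DiscreteHomotopy.IsHomotopyCriticalValue X ε ↔
      ∃ C : Set X, DiscreteHomotopy.IsEssentialCircle ε C := by
  constructor
  · rintro ⟨α, hα⟩
    obtain ⟨w, hw, hnot⟩ := hα.exists_regular_hexagon_not_null hX hε
    exact DiscreteHomotopy.exists_isEssentialCircle_of_hexagon hX hε hw hnot
  · rintro ⟨C, hC⟩
    exact DiscreteHomotopy.isHomotopyCriticalValue_of_isEssentialCircle hε hC
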